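/- Let $E$ be a Dedekind complete Riesz space (real vector lattice) with weak order unit $e$. Let $T:E\to E$ be a strictly positive conditional expectation operator with $Te=e$, that is: $T$ is a linear, positive, order continuous projection which maps weak order units to weak order units, whose range $R(T)$ is a Dedekind complete Riesz subspace of $E$, and such that $f\ge 0$, $Tf=0$ imply $f=0$. Let $S:E\to E$ be an order continuous Riesz homomorphism with $Se=e$ and $TSf=Tf$ for all $f\in E$, so that $(E,T,S,e)$ is a conditional expectation preserving system. Assume that the system is conditionally ergodic, i.e. for every $f\in E$ the Cesàro means $\frac1m\sum_{k=0}^{m-1}S^kf$ converge in order to $Tf$ as $m\to\infty$, and that $S$ is surjective. (Neither aperiodicity nor $T$-universal completeness of $E$ is assumed.) Let $n\ge 1$ be an integer and let $p$ be a component of $e$, i.e. $0\le p\le e$ and $(e-p)\wedge p=0$. Write $P_{Tp}$ for the band projection of $E$ onto the band generated by $Tp$. Then there exists a component $q$ of $P_{Tp}e$ such that $q, Sq,\dots,S^{n-1}q$ are pairwise disjoint and $$T\Bigl(\bigvee_{j=0}^{n-1}S^jq\Bigr)\ \ge\ \bigl(P_{Tp}e-(n-1)Tp\bigr)^+ .$$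 -/

import Mathlib

/-!
Throughout, a Dedekind complete Riesz space is a real vector space `E` with a compatible
conditionally complete lattice order:
`[AddCommGroup E] [ConditionallyCompleteLattice E] [IsOrderedAddMonoid E] [Module ℝ E]
[IsOrderedModule ℝ E]`.
-/

namespace RieszErgodic

noncomputable section

section Riesz

variable {E : Type*} [AddCommGroup E] [Lattice E]

/-- Disjointness `f ⊥ g` in a Riesz space. -/
def RieszDisjoint (f g : E) : Prop := |f| ⊓ |g| = 0

/-- `e` is a weak order unit: it is positive and only `0` is disjoint from it. -/
def IsWeakOrderUnit (e : E) : Prop := 0 ≤ e ∧ ∀ f : E, RieszDisjoint f e → f = 0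

/-- `p` is a component of `q`. -/
def IsComponent (p q : E) : Prop := 0 ≤ p ∧ p ≤ q ∧ (q - p) ⊓ p = 0

/-- Order convergence of a sequence. -/
def OrderTendsto (x : ℕ → E) (l : E) : Prop :=
  ∃ y : ℕ → E, Antitone y ∧ IsGLB (Set.range y) 0 ∧ ∀ n, |x n - l| ≤ y n

variable [Module ℝ E]

/-- A positive linear operator. -/
def IsPositiveOp (T : E →ₗ[ℝ] E) : Prop := ∀ f, 0 ≤ f → 0 ≤ T f

/-- A strictly positive operator: positive, and `T f = 0` with `0 ≤ f` forces `f = 0`. -/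
def IsStrictlyPositiveOp (T : E →ₗ[ℝ] E) : Prop :=
  IsPositiveOp T ∧ ∀ f, 0 ≤ f → T f = 0 → f = 0

/-- Order continuity of a positive operator: `D ↓ 0` implies `T D ↓ 0` for every downwards
directed set `D`. -/
def IsOrderContinuous (T : E →ₗ[ℝ] E) : Prop :=
  ∀ D : Set E, D.Nonempty → DirectedOn (· ≥ ·) D → IsGLB D 0 → IsGLB (T '' D) 0

/-- A Riesz (lattice) homomorphism. -/
def IsRieszHom (S : E →ₗ[ℝ] E) : Prop :=
  ∀ f g, S (f ⊔ g) = S f ⊔ S g ∧ S (f ⊓ g) = S f ⊓ S g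

/-- A Riesz subspace: a linear subspace closed under the lattice operations of `E`. -/
def IsRieszSubspace (F : Submodule ℝ E) : Prop :=
  ∀ f ∈ F, ∀ g ∈ F, f ⊔ g ∈ F ∧ f ⊓ g ∈ F

/-- `F`, with the order induced from `E`, is Dedekind complete in its own right. -/
def IsDedekindCompleteSubspace (F : Submodule ℝ E) : Prop :=
  ∀ A : Set F, A.Nonempty → BddAbove A → ∃ s : F, IsLUB A s

/-- A conditional expectation operator. -/
structure IsConditionalExpectation (T : E →ₗ[ℝ] E) : Prop where
  positive : IsPositiveOp T
  orderContinuous : IsOrderContinuous T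
  projection : ∀ f, T (T f) = T f
  map_weakOrderUnit : ∀ u, IsWeakOrderUnit u → IsWeakOrderUnit (T u)
  range_rieszSubspace : IsRieszSubspace (LinearMap.range T)
  range_dedekindComplete : IsDedekindCompleteSubspace (LinearMap.range T)

/-- A band: a solid linear subspace closed under all suprema that exist in `E`. -/
structure IsBand (B : Submodule ℝ E) : Prop where
  solid : ∀ f ∈ B, ∀ g, |g| ≤ |f| → g ∈ B
  sup_mem : ∀ A : Set E, A ⊆ B → ∀ s, IsLUB A s → s ∈ B

/-- The band generated by `u`. -/
def bandGenerated (u : E) : Submodule ℝ E := sInf {B | IsBand B ∧ u ∈ B}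

/-- The Cesàro mean `(1/n) ∑_{k<n} S^k f`. -/
def cesaro (S : E →ₗ[ℝ] E) (f : E) (n : ℕ) : E :=
  (n : ℝ)⁻¹ • ∑ k ∈ Finset.range n, (S ^ k) f

end Riesz

section DedekindComplete

variable {E : Type*} [AddCommGroup E] [ConditionallyCompleteLattice E] [Module ℝ E]

/-- The band projection onto the band `B` of a Dedekind complete Riesz space: on positive `f` it
is `sup {g ∈ B | 0 ≤ g ≤ f}`, and `P f = P f⁺ - P f⁻` in general. -/
def bandProj (B : Submodule ℝ E) (f : E) : E :=
  sSup {g | g ∈ B ∧ 0 ≤ g ∧ g ≤ f⁺} - sSup {g | g ∈ B ∧ 0 ≤ g ∧ g ≤ f⁻}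

/-- `(E, T, S, e)` is a conditional expectation preserving system. -/
structure IsCEPS (T S : E →ₗ[ℝ] E) (e : E) : Prop where
  weakOrderUnit : IsWeakOrderUnit e
  condExp : IsConditionalExpectation T
  T_unit : T e = e
  rieszHom : IsRieszHom S
  orderContinuous : IsOrderContinuous S
  S_unit : S e = e
  T_comp_S : ∀ f, T (S f) = T f

/-- Conditional ergodicity, `L_S = T`: for every `f` the Cesàro means of `f` converge in order
to `T f`. (No `T`-universal completeness of `E` is required; if `E = L¹(T)`, this is
conditional ergodicity in the usual sense.) -/
def IsConditionallyErgodic (T S : E →ₗ[ℝ] E) : Prop :=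
  ∀ f, OrderTendsto (cesaro S f) (T f)

end DedekindComplete

end

end RieszErgodic

/-!
Think of components of `e` as events and of `S f` as `f` composed with the dynamics. Let `pₖ` be
the event that the orbit of a point enters `p` for the first time at time `k`. The `pₖ` are
pairwise disjoint, their supremum is `w = ⋁ₖ Sᵏp`, and `pₖ₊ₘ ≤ Sᵐpₖ`. Hence the events `rᵢ` that
the first entry time is `≡ i` modulo `n` are pairwise disjoint and `rᵢ₊ₘ ≤ Sᵐrᵢ`. As `S` is an
order automorphism, `rₙ₋₁ = Sⁿ⁻¹q` for some `q`, and `Sⁱq ≤ rᵢ` for `i < n`, so `q, …, Sⁿ⁻¹q` are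
pairwise disjoint.

Every `pₖ` lies below `Sⁱp` for some `i < n - 1`, or below `Sⁱrₙ₋₁` for some `i < n`. The `pₖ`
therefore all lie below the sum of these elements, and so does `w`. Since `w` is invariant, `Tw = w`
and applying `T` gives `w ≤ n Tq + (n - 1) Tp`, where `n Tq` is `T` of the supremum of the tower.

Finally `w` is the band projection of `e` onto the band of `Tp`: that projection is
`v = ⋁ₖ e ⊓ k Tp`, which is fixed by `T`; strict positivity of `T` makes `p`, hence `w`, disjoint
from `e - v`, while `Tp ≤ Tw = w` gives `v ≤ w`.
-/

namespace RieszErgodic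

section LatticeOrderedGroup

variable {E : Type*} [AddCommGroup E] [Lattice E]

lemma inf_eq_zero_of_le {a b a' b' : E} (h : a ⊓ b = 0) (ha' : 0 ≤ a') (hb' : 0 ≤ b')
    (haa' : a' ≤ a) (hbb' : b' ≤ b) : a' ⊓ b' = 0 :=
  le_antisymm ((inf_le_inf haa' hbb').trans_eq h) (le_inf ha' hb')

variable [IsOrderedAddMonoid E]

lemma add_eq_sup_of_inf_eq_zero {a b : E} (h : a ⊓ b = 0) : a + b = a ⊔ b := by
  rw [← inf_add_sup a b, h, zero_add]

lemma add_inf_le_inf_add_inf {a b c : E} (ha : 0 ≤ a) (hb : 0 ≤ b) (hc : 0 ≤ c) :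
    (a + b) ⊓ c ≤ a ⊓ c + b ⊓ c := by
  simp only [add_inf, inf_add]
  exact le_inf (le_inf inf_le_left (inf_le_right.trans (le_add_of_nonneg_right hb)))
    (le_inf (inf_le_right.trans (le_add_of_nonneg_left ha))
      (inf_le_right.trans (le_add_of_nonneg_left hc)))

lemma add_inf_eq_zero {a b c : E} (ha : 0 ≤ a) (hb : 0 ≤ b) (hc : 0 ≤ c) (hac : a ⊓ c = 0)
    (hbc : b ⊓ c = 0) : (a + b) ⊓ c = 0 :=
  le_antisymm ((add_inf_le_inf_add_inf ha hb hc).trans_eq (by rw [hac, hbc, add_zero]))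
    (le_inf (add_nonneg ha hb) hc)

lemma nsmul_inf_eq_zero {a c : E} (ha : 0 ≤ a) (hc : 0 ≤ c) (hac : a ⊓ c = 0) (k : ℕ) :
    (k • a) ⊓ c = 0 := by
  induction k with
  | zero => simpa using hc
  | succ k ih =>
    rw [succ_nsmul]
    exact add_inf_eq_zero (nsmul_nonneg ha k) ha hc ih hac

lemma sum_inf_eq_zero {ι : Type*} {s : Finset ι} {x : ι → E} {c : E} (hx : ∀ i ∈ s, 0 ≤ x i)
    (hc : 0 ≤ c) (h : ∀ i ∈ s, x i ⊓ c = 0) : (∑ i ∈ s, x i) ⊓ c = 0 :=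
  (Finset.sum_induction x (fun y => 0 ≤ y ∧ y ⊓ c = 0)
    (fun _ _ ha hb => ⟨add_nonneg ha.1 hb.1, add_inf_eq_zero ha.1 hb.1 hc ha.2 hb.2⟩)
    ⟨le_rfl, inf_eq_left.2 hc⟩ fun i hi => ⟨hx i hi, h i hi⟩).2

lemma sum_le_of_pairwise_inf_eq_zero {ι : Type*} {s : Finset ι} {x : ι → E} {M : E}
    (hM : 0 ≤ M) (hx : ∀ i ∈ s, 0 ≤ x i) (hd : ∀ i ∈ s, ∀ j ∈ s, i ≠ j → x i ⊓ x j = 0)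
    (hxM : ∀ i ∈ s, x i ≤ M) : ∑ i ∈ s, x i ≤ M := by
  induction s using Finset.cons_induction with
  | empty => simpa using hM
  | cons a s has ih =>
    simp only [Finset.forall_mem_cons] at hx hd hxM
    have hdisj : x a ⊓ ∑ i ∈ s, x i = 0 := by
      rw [inf_comm]
      exact sum_inf_eq_zero hx.2 hx.1 fun i hi => (hd.2 i hi).1 (ne_of_mem_of_not_mem hi has)
    rw [Finset.sum_cons, add_eq_sup_of_inf_eq_zero hdisj]
    exact sup_le hxM.1 (ih hx.2 (fun i hi => (hd.2 i hi).2) hxM.2)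

lemma le_of_inf_sub_eq_zero {a b e : E} (hae : a ≤ e) (hb : 0 ≤ b) (h : a ⊓ (e - b) = 0) :
    a ≤ b := by
  have : a + (e - b) ≤ e := by
    rw [add_eq_sup_of_inf_eq_zero h]
    exact sup_le hae (sub_le_self e hb)
  rwa [← add_sub_assoc, sub_le_iff_le_add, add_comm e b, add_le_add_iff_right] at this

lemma isLUB_image_inf_right {A : Set E} {s : E} (hA : IsLUB A s) (c : E) :
    IsLUB ((· ⊓ c) '' A) (s ⊓ c) := by
  refine ⟨Set.forall_mem_image.2 fun a ha => inf_le_inf_right c (hA.1 ha), fun u hu => ?_⟩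
  have hs : s ≤ u + s ⊔ c - c := hA.2 fun a ha => by
    rw [le_sub_iff_add_le, ← inf_add_sup]
    exact add_le_add (hu ⟨a, ha, rfl⟩) (sup_le_sup_right (hA.1 ha) c)
  rwa [le_sub_iff_add_le, ← inf_add_sup, add_le_add_iff_right] at hs

lemma inf_eq_zero_of_isLUB {A : Set E} {s c : E} (hA : IsLUB A s) (hs : 0 ≤ s) (hc : 0 ≤ c)
    (h : ∀ a ∈ A, a ⊓ c ≤ 0) : s ⊓ c = 0 :=
  le_antisymm ((isLUB_image_inf_right hA c).2 (Set.forall_mem_image.2 h)) (le_inf hs hc)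

lemma rieszDisjoint_of_inf_eq_zero {a b : E} (ha : 0 ≤ a) (hb : 0 ≤ b) (h : a ⊓ b = 0) :
    RieszDisjoint a b := by
  rwa [RieszDisjoint, abs_of_nonneg ha, abs_of_nonneg hb]

lemma OrderTendsto.eq_of_eventually_const {x : ℕ → E} {l a : E} (h : OrderTendsto x l)
    (hx : ∀ m, m ≠ 0 → x m = a) : l = a := by
  obtain ⟨y, hy, hy0, hxy⟩ := h
  have habs : |a - l| ≤ 0 := hy0.2 <| Set.forall_mem_range.2 fun k =>
    (hx _ k.succ_ne_zero ▸ hxy (k + 1)).trans (hy k.le_succ)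
  obtain ⟨hal, hla⟩ := abs_le'.1 habs
  exact le_antisymm (by simpa using hla) (by simpa using hal)

end LatticeOrderedGroup

namespace IsComponent

variable {E : Type*} [AddCommGroup E] [Lattice E] {a b e : E}

lemma inf_sub (ha : IsComponent a e) : a ⊓ (e - a) = 0 := inf_comm a (e - a) ▸ ha.2.2

variable [IsOrderedAddMonoid E]

lemma compl (ha : IsComponent a e) : IsComponent (e - a) e :=
  ⟨sub_nonneg.2 ha.2.1, sub_le_self e ha.1, by rw [sub_sub_cancel, ha.inf_sub]⟩

lemma inf (ha : IsComponent a e) (hb : IsComponent b e) : IsComponent (a ⊓ b) e := by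
  have h0 : 0 ≤ a ⊓ b := le_inf ha.1 hb.1
  refine ⟨h0, inf_le_left.trans ha.2.1, ?_⟩
  rw [sub_inf]
  refine inf_eq_zero_of_isLUB isLUB_pair (ha.compl.1.trans le_sup_left) h0 ?_
  rintro _ (rfl | rfl)
  exacts [(inf_le_inf_left _ inf_le_left).trans_eq ha.2.2,
    (inf_le_inf_left _ inf_le_right).trans_eq hb.2.2]

lemma of_isLUB {A : Set E} {s : E} (hA : IsLUB A s) (hne : A.Nonempty)
    (h : ∀ a ∈ A, IsComponent a e) : IsComponent s e := by
  obtain ⟨a, ha⟩ := hne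
  have hs : 0 ≤ s := (h a ha).1.trans (hA.1 ha)
  have hse : s ≤ e := hA.2 fun b hb => (h b hb).2.1
  refine ⟨hs, hse, ?_⟩
  rw [inf_comm]
  exact inf_eq_zero_of_isLUB hA hs (sub_nonneg.2 hse) fun b hb =>
    (inf_le_inf_left b (sub_le_sub_left (hA.1 hb) e)).trans_eq (h b hb).inf_sub

lemma of_le (ha : IsComponent a e) (hab : a ≤ b) (hbe : b ≤ e) : IsComponent a b :=
  ⟨ha.1, hab, inf_eq_zero_of_le ha.2.2 (sub_nonneg.2 hab) ha.1 (sub_le_sub_right hbe a) le_rfl⟩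

lemma inf_nsmul_le (ha : IsComponent a e) (k : ℕ) : e ⊓ k • a ≤ a := by
  have hk : (e - a) ⊓ k • a = 0 := by
    rw [inf_comm]
    exact nsmul_inf_eq_zero ha.1 ha.compl.1 ha.inf_sub k
  calc e ⊓ k • a = (e - a + a) ⊓ k • a := by rw [sub_add_cancel]
    _ ≤ (e - a) ⊓ k • a + a ⊓ k • a :=
      add_inf_le_inf_add_inf ha.compl.1 ha.1 (nsmul_nonneg ha.1 k)
    _ ≤ a := by
      rw [hk, zero_add]
      exact inf_le_left

end IsComponent

section Band

variable {E : Type*} [AddCommGroup E] [Lattice E]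

lemma abs_smul_le {R : Type*} [Ring R] [LinearOrder R] [IsOrderedRing R] [Module R E]
    [PosSMulMono R E] (r : R) (f : E) : |r • f| ≤ |r| • |f| := by
  have smul_le (g : E) : r • g ≤ |r| • |g| := by
    rcases abs_cases r with ⟨hr, -⟩ | ⟨hr, -⟩
    · nth_rw 1 [← hr]
      exact smul_le_smul_of_nonneg_left (le_abs_self g) (abs_nonneg r)
    · rw [← neg_smul_neg r g, ← hr]
      exact smul_le_smul_of_nonneg_left (neg_le_abs g) (abs_nonneg r)
  refine abs_le'.2 ⟨smul_le f, ?_⟩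
  rw [← smul_neg, ← abs_neg f]
  exact smul_le (-f)

variable [IsOrderedAddMonoid E] [Module ℝ E] [IsOrderedModule ℝ E]

/-- The disjoint complement `{c}ᵈ`, the set of all elements disjoint from `c`, as a linear
subspace. -/
def disjointComplement (c : E) : Submodule ℝ E where
  carrier := {f | RieszDisjoint f c}
  zero_mem' := by simp [RieszDisjoint]
  add_mem' {f g} hf hg :=
    inf_eq_zero_of_le (add_inf_eq_zero (abs_nonneg f) (abs_nonneg g) (abs_nonneg c) hf hg)
      (abs_nonneg _) (abs_nonneg c) (abs_add_le f g) le_rfl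
  smul_mem' r f hf := by
    refine inf_eq_zero_of_le (nsmul_inf_eq_zero (abs_nonneg f) (abs_nonneg c) hf ⌈|r|⌉₊)
      (abs_nonneg _) (abs_nonneg c) ((abs_smul_le r f).trans ?_) le_rfl
    rw [← Nat.cast_smul_eq_nsmul ℝ]
    exact smul_le_smul_of_nonneg_right (Nat.le_ceil _) (abs_nonneg f)

lemma isBand_disjointComplement (c : E) : IsBand (disjointComplement c) where
  solid f hf g hg := inf_eq_zero_of_le hf (abs_nonneg g) (abs_nonneg c) hg le_rfl
  sup_mem A hA s hs := by
    have hpos : s ⊓ |c| ≤ 0 := (isLUB_image_inf_right hs |c|).2 <|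
      Set.forall_mem_image.2 fun a ha => (inf_le_inf_right _ (le_abs_self a)).trans_eq (hA ha)
    have hneg : -s ⊓ |c| ≤ 0 := by
      rcases A.eq_empty_or_nonempty with rfl | ⟨a, ha⟩
      · have hbot (x : E) : s ≤ x := hs.2 (by simp)
        exact inf_le_right.trans (by simpa using hbot (s - |c|))
      · exact (inf_le_inf_right _ ((neg_le_neg (hs.1 ha)).trans (neg_le_abs a))).trans_eq (hA ha)
    refine inf_eq_zero_of_isLUB isLUB_pair (abs_nonneg s) (abs_nonneg c) ?_
    rintro _ (rfl | rfl)
    exacts [hpos, hneg]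

end Band

section PrincipalBand

variable {E : Type*} [AddCommGroup E] [ConditionallyCompleteLattice E]

lemma isLUB_iSup_inf_nsmul (e u : E) :
    IsLUB (Set.range fun k : ℕ => e ⊓ k • u) (⨆ k : ℕ, e ⊓ k • u) :=
  isLUB_ciSup ⟨e, Set.forall_mem_range.2 fun _ => inf_le_left⟩

lemma iSup_inf_nsmul_nonneg {e u : E} (he : 0 ≤ e) : 0 ≤ ⨆ k : ℕ, e ⊓ k • u :=
  le_trans (by simpa using he) ((isLUB_iSup_inf_nsmul e u).1 ⟨0, rfl⟩)

variable [IsOrderedAddMonoid E]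

lemma inf_sub_iSup_inf_nsmul {e u : E} (hu : 0 ≤ u) : u ⊓ (e - ⨆ k : ℕ, e ⊓ k • u) = 0 := by
  have hv := isLUB_iSup_inf_nsmul e u
  set v := ⨆ k : ℕ, e ⊓ k • u
  have hve : v ≤ e := hv.2 (Set.forall_mem_range.2 fun _ => inf_le_left)
  refine le_antisymm ?_ (le_inf hu (sub_nonneg.2 hve))
  have : v ≤ v - u ⊓ (e - v) := hv.2 <| Set.forall_mem_range.2 fun k => by
    rw [le_sub_iff_add_le]
    refine le_trans (le_inf ?_ ?_) (hv.1 ⟨k + 1, rfl⟩)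
    · exact (add_le_add (hv.1 ⟨k, rfl⟩) inf_le_right).trans_eq (add_sub_cancel v e)
    · exact (add_le_add inf_le_right inf_le_left).trans_eq (succ_nsmul u k).symm
  simpa using this

variable [Module ℝ E]

lemma bandProj_of_nonneg (B : Submodule ℝ E) {f : E} (hf : 0 ≤ f) :
    bandProj B f = sSup {g | g ∈ B ∧ 0 ≤ g ∧ g ≤ f} := by
  have hzero : {g | g ∈ B ∧ 0 ≤ g ∧ g ≤ (0 : E)} = {0} := Set.eq_singleton_iff_unique_mem.2
    ⟨⟨zero_mem B, le_rfl, le_rfl⟩, fun _ hg => le_antisymm hg.2.2 hg.2.1⟩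
  rw [bandProj, posPart_of_nonneg hf, negPart_eq_zero.2 hf, hzero, csSup_singleton, sub_zero]

lemma iSup_inf_nsmul_mem_bandGenerated {e u : E} (he : 0 ≤ e) (hu : 0 ≤ u) :
    ⨆ k : ℕ, e ⊓ k • u ∈ bandGenerated u := by
  refine Submodule.mem_sInf.2 fun B hB => hB.1.sup_mem _ ?_ _ (isLUB_iSup_inf_nsmul e u)
  refine Set.range_subset_iff.2 fun k => hB.1.solid (k • u) (nsmul_mem hB.2 k) _ ?_
  have hk : 0 ≤ k • u := nsmul_nonneg hu k
  rw [abs_of_nonneg (le_inf he hk), abs_of_nonneg hk]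
  exact inf_le_right

lemma bandProj_bandGenerated_eq_iSup [IsOrderedModule ℝ E] {e u : E} (he : 0 ≤ e) (hu : 0 ≤ u) :
    bandProj (bandGenerated u) e = ⨆ k : ℕ, e ⊓ k • u := by
  have hv0 := iSup_inf_nsmul_nonneg (u := u) he
  have hve : ⨆ k : ℕ, e ⊓ k • u ≤ e := ciSup_le fun _ => inf_le_left
  rw [bandProj_of_nonneg _ he]
  refine IsLUB.csSup_eq ⟨?_, fun _ hM => hM ⟨iSup_inf_nsmul_mem_bandGenerated he hu, hv0, hve⟩⟩
    ⟨0, zero_mem _, le_rfl, he⟩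
  rintro g ⟨hg, hg0, hge⟩
  have hc : 0 ≤ e - ⨆ k : ℕ, e ⊓ k • u := sub_nonneg.2 hve
  have hdisj : RieszDisjoint g (e - ⨆ k : ℕ, e ⊓ k • u) :=
    Submodule.mem_sInf.1 hg (disjointComplement _) ⟨isBand_disjointComplement _,
      rieszDisjoint_of_inf_eq_zero hu hc (inf_sub_iSup_inf_nsmul hu)⟩
  rw [RieszDisjoint, abs_of_nonneg hg0, abs_of_nonneg hc] at hdisj
  exact le_of_inf_sub_eq_zero hge hv0 hdisj

end PrincipalBand

section Operator

variable {E : Type*} [AddCommGroup E] [Module ℝ E]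

lemma pow_apply_eq_self {S : E →ₗ[ℝ] E} {f : E} (hf : S f = f) (m : ℕ) : (S ^ m) f = f := by
  rw [Module.End.pow_apply]
  exact Function.iterate_fixed hf m

lemma apply_pow_eq {T S : E →ₗ[ℝ] E} (hTS : ∀ f, T (S f) = T f) (m : ℕ) (f : E) :
    T ((S ^ m) f) = T f := by
  induction m with
  | zero => simp
  | succ m ih => rw [pow_succ', Module.End.mul_apply, hTS, ih]

lemma cesaro_of_fixed {S : E →ₗ[ℝ] E} {f : E} (hf : S f = f) {m : ℕ} (hm : m ≠ 0) :
    cesaro S f m = f := by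
  simp only [cesaro, pow_apply_eq_self hf, Finset.sum_const, Finset.card_range]
  rw [← Nat.cast_smul_eq_nsmul ℝ, inv_smul_smul₀ (Nat.cast_ne_zero.2 hm)]

variable [Lattice E]

namespace IsRieszHom

variable {S : E →ₗ[ℝ] E}

lemma pow (hS : IsRieszHom S) (m : ℕ) : IsRieszHom (S ^ m) := by
  induction m with
  | zero => intro f g; simp
  | succ m ih =>
    intro f g
    simp only [pow_succ, Module.End.mul_apply, (hS f g).1, (hS f g).2]
    exact ih _ _

lemma monotone (hS : IsRieszHom S) : Monotone S := fun f g hfg => by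
  rw [← sup_eq_right, ← (hS f g).1, sup_eq_right.2 hfg]

lemma map_nonneg (hS : IsRieszHom S) {f : E} (hf : 0 ≤ f) : 0 ≤ S f :=
  (map_zero S).ge.trans (hS.monotone hf)

lemma map_le_map_iff (hS : IsRieszHom S) (hinj : Function.Injective S) {f g : E} :
    S f ≤ S g ↔ f ≤ g := by
  rw [← sup_eq_right, ← (hS f g).1, hinj.eq_iff, sup_eq_right]

lemma isComponent_map (hS : IsRieszHom S) {a e : E} (ha : IsComponent a e) :
    IsComponent (S a) (S e) :=
  ⟨hS.map_nonneg ha.1, hS.monotone ha.2.1, by rw [← map_sub, ← (hS _ _).2, ha.2.2, map_zero]⟩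

lemma isComponent_map_iff (hS : IsRieszHom S) (hinj : Function.Injective S) {a e : E} :
    IsComponent (S a) (S e) ↔ IsComponent a e := by
  refine ⟨fun ⟨h0, hle, hinf⟩ => ⟨?_, (hS.map_le_map_iff hinj).1 hle, ?_⟩, hS.isComponent_map⟩
  · rwa [← map_zero S, hS.map_le_map_iff hinj] at h0
  · rwa [← map_sub, ← (hS _ _).2, map_eq_zero_iff S hinj] at hinf

end IsRieszHom

variable [IsOrderedAddMonoid E]

lemma IsPositiveOp.monotone {T : E →ₗ[ℝ] E} (hT : IsPositiveOp T) : Monotone T := fun f g hfg => by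
  simpa using hT (g - f) (sub_nonneg.2 hfg)

namespace IsStrictlyPositiveOp

variable {T : E →ₗ[ℝ] E}

lemma eq_of_le_of_map_eq (hT : IsStrictlyPositiveOp T) {f g : E} (hfg : f ≤ g)
    (h : T f = T g) : f = g :=
  (sub_eq_zero.1 (hT.2 _ (sub_nonneg.2 hfg) (by rw [map_sub, h, sub_self]))).symm

lemma map_inf_of_fixed (hT : IsStrictlyPositiveOp T) (hproj : ∀ f, T (T f) = T f) {f g : E}
    (hf : T f = f) (hg : T g = g) : T (f ⊓ g) = f ⊓ g :=
  hT.eq_of_le_of_map_eq (le_inf ((hT.1.monotone inf_le_left).trans_eq hf)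
    ((hT.1.monotone inf_le_right).trans_eq hg)) (hproj _)

lemma map_isLUB_of_fixed (hT : IsStrictlyPositiveOp T) (hproj : ∀ f, T (T f) = T f) {A : Set E}
    {s : E} (hA : IsLUB A s) (h : ∀ a ∈ A, T a = a) : T s = s :=
  (hT.eq_of_le_of_map_eq (hA.2 fun a ha => (h a ha).ge.trans (hT.1.monotone (hA.1 ha)))
    (hproj s).symm).symm

lemma inf_eq_zero_of_fixed (hT : IsStrictlyPositiveOp T) {f c : E} (hf : 0 ≤ f) (hc : 0 ≤ c)
    (hTc : T c = c) (h : T f ⊓ c = 0) : f ⊓ c = 0 := by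
  have h0 : 0 ≤ f ⊓ c := le_inf hf hc
  refine hT.2 _ h0 (le_antisymm ?_ (hT.1 _ h0))
  exact h ▸ le_inf (hT.1.monotone inf_le_left) ((hT.1.monotone inf_le_right).trans_eq hTc)

end IsStrictlyPositiveOp

lemma IsRieszHom.injective_of_comp_eq {T S : E →ₗ[ℝ] E} (hS : IsRieszHom S)
    (hT : IsStrictlyPositiveOp T) (hTS : ∀ f, T (S f) = T f) : Function.Injective S := by
  refine (injective_iff_map_eq_zero S).2 fun f hf => ?_
  have habs : S |f| = 0 := by rw [abs, (hS _ _).1, map_neg, hf, neg_zero, sup_idem]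
  have h0 : |f| = 0 := hT.2 _ (abs_nonneg f) (by rw [← hTS, habs, map_zero])
  obtain ⟨hle, hneg⟩ := abs_le'.1 h0.le
  exact le_antisymm hle (by simpa using hneg)

end Operator

section FirstEntry

/-- The component of `e` on which the orbit under the dynamics `S` enters `p` for the first time
at time `k`. -/
def firstEntry {E : Type*} [AddCommGroup E] [Lattice E] [Module ℝ E] (S : E →ₗ[ℝ] E) (e p : E) :
    ℕ → E
  | 0 => p
  | k + 1 => S (firstEntry S e p k) ⊓ (e - p)

variable {E : Type*} [AddCommGroup E] [Lattice E] [Module ℝ E] {S : E →ₗ[ℝ] E} {e p : E}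

lemma firstEntry_add_le (hS : IsRieszHom S) (k m : ℕ) :
    firstEntry S e p (k + m) ≤ (S ^ m) (firstEntry S e p k) := by
  induction m with
  | zero => simp
  | succ m ih =>
    rw [pow_succ', Module.End.mul_apply]
    exact inf_le_left.trans (hS.monotone ih)

lemma firstEntry_le_pow (hS : IsRieszHom S) (k : ℕ) : firstEntry S e p k ≤ (S ^ k) p := by
  simpa [firstEntry] using firstEntry_add_le (e := e) (p := p) hS 0 k

variable [IsOrderedAddMonoid E]

lemma firstEntry_isComponent (hS : IsRieszHom S) (hSe : S e = e) (hp : IsComponent p e) (k : ℕ) :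
    IsComponent (firstEntry S e p k) e := by
  induction k with
  | zero => exact hp
  | succ k ih => exact (hSe ▸ hS.isComponent_map ih).inf hp.compl

lemma firstEntry_inf_of_lt (hS : IsRieszHom S) (hSe : S e = e) (hp : IsComponent p e) {i j : ℕ}
    (hij : i < j) : firstEntry S e p i ⊓ firstEntry S e p j = 0 := by
  have hnonneg (k : ℕ) := (firstEntry_isComponent hS hSe hp k).1
  induction i generalizing j with
  | zero =>
    obtain ⟨j, rfl⟩ := Nat.exists_eq_add_of_le' hij
    exact inf_eq_zero_of_le hp.inf_sub hp.1 (hnonneg _) le_rfl inf_le_right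
  | succ i ih =>
    obtain ⟨j, rfl⟩ := Nat.exists_eq_add_of_le' (Nat.zero_lt_of_lt hij)
    have h : S (firstEntry S e p i) ⊓ S (firstEntry S e p j) = 0 := by
      rw [← (hS _ _).2, ih (Nat.lt_of_succ_lt_succ hij), map_zero]
    exact inf_eq_zero_of_le h (hnonneg _) (hnonneg _) inf_le_left inf_le_left

lemma firstEntry_inf_of_ne (hS : IsRieszHom S) (hSe : S e = e) (hp : IsComponent p e) {i j : ℕ}
    (hij : i ≠ j) : firstEntry S e p i ⊓ firstEntry S e p j = 0 := by
  rcases hij.lt_or_gt with h | h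
  · exact firstEntry_inf_of_lt hS hSe hp h
  · rw [inf_comm, firstEntry_inf_of_lt hS hSe hp h]

lemma map_firstEntry_le_sup (hS : IsRieszHom S) (hSe : S e = e) (hp : IsComponent p e) (k : ℕ) :
    S (firstEntry S e p k) ≤ p ⊔ firstEntry S e p (k + 1) := by
  obtain ⟨h0, hle, -⟩ := hSe ▸ hS.isComponent_map (firstEntry_isComponent hS hSe hp k)
  have hdisj : p ⊓ firstEntry S e p (k + 1) = 0 := firstEntry_inf_of_lt hS hSe hp k.succ_pos
  rw [← add_eq_sup_of_inf_eq_zero hdisj]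
  calc S (firstEntry S e p k) = (p + (e - p)) ⊓ S (firstEntry S e p k) := by
        rw [add_sub_cancel, inf_eq_right.2 hle]
    _ ≤ p ⊓ S (firstEntry S e p k) + (e - p) ⊓ S (firstEntry S e p k) :=
      add_inf_le_inf_add_inf hp.1 hp.compl.1 h0
    _ ≤ p + firstEntry S e p (k + 1) := add_le_add inf_le_left (inf_comm _ _).le

lemma pow_le_of_firstEntry_le (hS : IsRieszHom S) (hSe : S e = e) (hp : IsComponent p e) {u : E}
    (hu : ∀ k, firstEntry S e p k ≤ u) (k : ℕ) : (S ^ k) p ≤ u := by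
  suffices h : ∀ l, (S ^ k) (firstEntry S e p l) ≤ u from h 0
  induction k with
  | zero => exact hu
  | succ k ih =>
    intro l
    rw [pow_succ, Module.End.mul_apply]
    refine ((hS.pow k).monotone (map_firstEntry_le_sup hS hSe hp l)).trans ?_
    rw [(hS.pow k _ _).1]
    exact sup_le (ih 0) (ih (l + 1))

end FirstEntry

section Tower

variable {E : Type*} [AddCommGroup E] [ConditionallyCompleteLattice E]

lemma isLUB_iSup_of_isComponent {ι : Type*} [Nonempty ι] {x : ι → E} {e : E}
    (hx : ∀ i, IsComponent (x i) e) : IsLUB (Set.range x) (⨆ i, x i) :=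
  isLUB_ciSup ⟨e, Set.forall_mem_range.2 fun i => (hx i).2.1⟩

variable [Module ℝ E]

/-- The supremum `⋁ₖ Sᵏp` of the forward orbit of `p`: the component on which the dynamics ever
enters `p`. -/
noncomputable def orbitSup (S : E →ₗ[ℝ] E) (p : E) : E := ⨆ k : ℕ, (S ^ k) p

/-- The component of `e` on which the first entry time into `p` is congruent to `i` modulo `n`,
where `i < n` is intended. -/
noncomputable def entryTimeClass (S : E →ₗ[ℝ] E) (e p : E) (n i : ℕ) : E :=
  ⨆ j : ℕ, firstEntry S e p (j * n + i)

variable {S : E →ₗ[ℝ] E} {e p : E}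

lemma isComponent_pow (hS : IsRieszHom S) (hSe : S e = e) (hp : IsComponent p e) (k : ℕ) :
    IsComponent ((S ^ k) p) e := by
  simpa only [pow_apply_eq_self hSe] using (hS.pow k).isComponent_map hp

lemma isLUB_orbitSup (hS : IsRieszHom S) (hSe : S e = e) (hp : IsComponent p e) :
    IsLUB (Set.range fun k : ℕ => (S ^ k) p) (orbitSup S p) :=
  isLUB_iSup_of_isComponent (isComponent_pow hS hSe hp)

lemma map_orbitSup_le (hS : IsRieszHom S) (hinj : Function.Injective S)
    (hsurj : Function.Surjective S) (hSe : S e = e) (hp : IsComponent p e) :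
    S (orbitSup S p) ≤ orbitSup S p := by
  have hw := isLUB_orbitSup hS hSe hp
  obtain ⟨u, hu⟩ := hsurj (orbitSup S p)
  have hle : orbitSup S p ≤ u := hw.2 <| Set.forall_mem_range.2 fun k => by
    rw [← hS.map_le_map_iff hinj, hu, ← Module.End.mul_apply, ← pow_succ']
    exact hw.1 ⟨k + 1, rfl⟩
  exact (hS.monotone hle).trans_eq hu

variable [IsOrderedAddMonoid E]

lemma orbitSup_isComponent (hS : IsRieszHom S) (hSe : S e = e) (hp : IsComponent p e) :
    IsComponent (orbitSup S p) e :=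
  .of_isLUB (isLUB_orbitSup hS hSe hp) (Set.range_nonempty _)
    (Set.forall_mem_range.2 (isComponent_pow hS hSe hp))

lemma isLUB_entryTimeClass (hS : IsRieszHom S) (hSe : S e = e) (hp : IsComponent p e)
    (n i : ℕ) : IsLUB (Set.range fun j => firstEntry S e p (j * n + i))
      (entryTimeClass S e p n i) :=
  isLUB_iSup_of_isComponent fun _ => firstEntry_isComponent hS hSe hp _

lemma entryTimeClass_isComponent (hS : IsRieszHom S) (hSe : S e = e) (hp : IsComponent p e)
    (n i : ℕ) : IsComponent (entryTimeClass S e p n i) e :=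
  .of_isLUB (isLUB_entryTimeClass hS hSe hp n i) (Set.range_nonempty _)
    (Set.forall_mem_range.2 fun _ => firstEntry_isComponent hS hSe hp _)

lemma entryTimeClass_inf (hS : IsRieszHom S) (hSe : S e = e) (hp : IsComponent p e)
    {n i j : ℕ} (hi : i < n) (hj : j < n) (hij : i ≠ j) :
    entryTimeClass S e p n i ⊓ entryTimeClass S e p n j = 0 := by
  have hnonneg (l : ℕ) := (entryTimeClass_isComponent hS hSe hp n l).1
  refine inf_eq_zero_of_isLUB (isLUB_entryTimeClass hS hSe hp n i) (hnonneg i) (hnonneg j)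
    (Set.forall_mem_range.2 fun k => ?_)
  rw [inf_comm]
  refine (inf_eq_zero_of_isLUB (isLUB_entryTimeClass hS hSe hp n j) (hnonneg j)
    (firstEntry_isComponent hS hSe hp _).1 (Set.forall_mem_range.2 fun l => ?_)).le
  refine (firstEntry_inf_of_ne hS hSe hp fun h => hij ?_).le
  have hmod := congrArg (· % n) h
  simpa [Nat.mul_add_mod', Nat.mod_eq_of_lt hi, Nat.mod_eq_of_lt hj, eq_comm] using hmod

lemma entryTimeClass_add_le (hS : IsRieszHom S) (hSe : S e = e) (hp : IsComponent p e)
    (n i m : ℕ) : entryTimeClass S e p n (i + m) ≤ (S ^ m) (entryTimeClass S e p n i) :=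
  (isLUB_entryTimeClass hS hSe hp n (i + m)).2 <| Set.forall_mem_range.2 fun j =>
    (add_assoc (j * n) i m ▸ firstEntry_add_le hS (j * n + i) m).trans
      ((hS.pow m).monotone ((isLUB_entryTimeClass hS hSe hp n i).1 ⟨j, rfl⟩))

lemma entryTimeClass_le_orbitSup (hS : IsRieszHom S) (hSe : S e = e) (hp : IsComponent p e)
    (n i : ℕ) : entryTimeClass S e p n i ≤ orbitSup S p :=
  (isLUB_entryTimeClass hS hSe hp n i).2 <| Set.forall_mem_range.2 fun _ =>
    (firstEntry_le_pow hS _).trans ((isLUB_orbitSup hS hSe hp).1 ⟨_, rfl⟩)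

lemma orbitSup_le_sum_add_sum (hS : IsRieszHom S) (hSe : S e = e) (hp : IsComponent p e) (m : ℕ) :
    orbitSup S p ≤ ∑ i ∈ Finset.range (m + 1), (S ^ i) (entryTimeClass S e p (m + 1) m) +
      ∑ i ∈ Finset.range m, (S ^ i) p := by
  have hr := entryTimeClass_isComponent hS hSe hp (m + 1) m
  have hr0 (i : ℕ) : 0 ≤ (S ^ i) (entryTimeClass S e p (m + 1) m) := (hS.pow i).map_nonneg hr.1
  have hp0 (i : ℕ) : 0 ≤ (S ^ i) p := (hS.pow i).map_nonneg hp.1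
  refine (isLUB_orbitSup hS hSe hp).2 <| Set.forall_mem_range.2 <|
    pow_le_of_firstEntry_le hS hSe hp fun k => ?_
  rcases lt_or_ge k m with hk | hk
  · calc firstEntry S e p k ≤ (S ^ k) p := firstEntry_le_pow hS k
      _ ≤ ∑ i ∈ Finset.range m, (S ^ i) p :=
        Finset.single_le_sum (fun i _ => hp0 i) (Finset.mem_range.2 hk)
      _ ≤ _ := le_add_of_nonneg_left (Finset.sum_nonneg fun i _ => hr0 i)
  · obtain ⟨j, i, hi, rfl⟩ : ∃ j i, i < m + 1 ∧ k = j * (m + 1) + m + i :=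
      ⟨(k - m) / (m + 1), (k - m) % (m + 1), Nat.mod_lt _ m.succ_pos, by
        have := Nat.div_add_mod' (k - m) (m + 1)
        omega⟩
    calc firstEntry S e p (j * (m + 1) + m + i)
        ≤ (S ^ i) (firstEntry S e p (j * (m + 1) + m)) := firstEntry_add_le hS _ i
      _ ≤ (S ^ i) (entryTimeClass S e p (m + 1) m) :=
        (hS.pow i).monotone ((isLUB_entryTimeClass hS hSe hp (m + 1) m).1 ⟨j, rfl⟩)
      _ ≤ ∑ i ∈ Finset.range (m + 1), (S ^ i) (entryTimeClass S e p (m + 1) m) :=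
        Finset.single_le_sum (fun i _ => hr0 i) (Finset.mem_range.2 hi)
      _ ≤ _ := le_add_of_nonneg_right (Finset.sum_nonneg fun i _ => hp0 i)

lemma exists_tower (hS : IsRieszHom S) (hinj : Function.Injective S)
    (hsurj : Function.Surjective S) (hSe : S e = e) (hp : IsComponent p e)
    (hw : S (orbitSup S p) = orbitSup S p) (m : ℕ) :
    ∃ q, IsComponent q (orbitSup S p) ∧
      (∀ i < m + 1, ∀ j < m + 1, i ≠ j → (S ^ i) q ⊓ (S ^ j) q = 0) ∧
      orbitSup S p ≤ ∑ i ∈ Finset.range (m + 1), (S ^ (i + m)) q +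
        ∑ i ∈ Finset.range m, (S ^ i) p := by
  have hinj_pow (k : ℕ) : Function.Injective (S ^ k) := Module.End.coe_pow S k ▸ hinj.iterate k
  have hsurj_pow : Function.Surjective (S ^ m) := Module.End.coe_pow S m ▸ hsurj.iterate m
  obtain ⟨q, hq⟩ := hsurj_pow (entryTimeClass S e p (m + 1) m)
  have hqw : IsComponent q (orbitSup S p) := by
    rw [← (hS.pow m).isComponent_map_iff (hinj_pow m), hq, pow_apply_eq_self hw]
    exact (entryTimeClass_isComponent hS hSe hp _ _).of_le
      (entryTimeClass_le_orbitSup hS hSe hp _ _) (orbitSup_isComponent hS hSe hp).2.1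
  have hq0 (i : ℕ) : 0 ≤ (S ^ i) q := (hS.pow i).map_nonneg hqw.1
  have hlevel (i : ℕ) (hi : i < m + 1) : (S ^ i) q ≤ entryTimeClass S e p (m + 1) i := by
    obtain ⟨l, rfl⟩ := Nat.exists_eq_add_of_le (Nat.le_of_lt_succ hi)
    rw [← (hS.pow l).map_le_map_iff (hinj_pow l), ← Module.End.mul_apply, ← pow_add, add_comm l,
      hq]
    exact entryTimeClass_add_le hS hSe hp _ i l
  refine ⟨q, hqw, fun i hi j hj hij => ?_, ?_⟩
  · exact inf_eq_zero_of_le (entryTimeClass_inf hS hSe hp hi hj hij) (hq0 i) (hq0 j)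
      (hlevel i hi) (hlevel j hj)
  · simp only [pow_add, Module.End.mul_apply, hq]
    exact orbitSup_le_sum_add_sum hS hSe hp m

end Tower

section System

variable {E : Type*} [AddCommGroup E] [ConditionallyCompleteLattice E] [IsOrderedAddMonoid E]
  [Module ℝ E] {T S : E →ₗ[ℝ] E} {e p : E}

lemma IsConditionallyErgodic.map_eq_of_fixed (herg : IsConditionallyErgodic T S) {f : E}
    (hf : S f = f) : T f = f :=
  (herg f).eq_of_eventually_const fun _ hm => cesaro_of_fixed hf hm

lemma map_orbitSup (hT : IsStrictlyPositiveOp T) (hS : IsRieszHom S)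
    (hsurj : Function.Surjective S) (hTS : ∀ f, T (S f) = T f) (hSe : S e = e)
    (hp : IsComponent p e) : S (orbitSup S p) = orbitSup S p :=
  hT.eq_of_le_of_map_eq (map_orbitSup_le hS (hS.injective_of_comp_eq hT hTS) hsurj hSe hp) (hTS _)

lemma orbitSup_le_iSup_inf_nsmul (hT : IsStrictlyPositiveOp T) (hproj : ∀ f, T (T f) = T f)
    (hTe : T e = e) (hS : IsRieszHom S) (hTS : ∀ f, T (S f) = T f) (hSe : S e = e)
    (hp : IsComponent p e) : orbitSup S p ≤ ⨆ k : ℕ, e ⊓ k • T p := by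
  have hv0 : 0 ≤ ⨆ k : ℕ, e ⊓ k • T p := iSup_inf_nsmul_nonneg (hp.1.trans hp.2.1)
  have hve : ⨆ k : ℕ, e ⊓ k • T p ≤ e := ciSup_le fun _ => inf_le_left
  have hTv : T (⨆ k : ℕ, e ⊓ k • T p) = ⨆ k : ℕ, e ⊓ k • T p :=
    hT.map_isLUB_of_fixed hproj (isLUB_iSup_inf_nsmul e (T p)) <| Set.forall_mem_range.2 fun k =>
      hT.map_inf_of_fixed hproj hTe (by rw [map_nsmul, hproj])
  refine (isLUB_orbitSup hS hSe hp).2 <| Set.forall_mem_range.2 fun k => ?_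
  obtain ⟨hk0, hke, -⟩ := isComponent_pow hS hSe hp k
  refine le_of_inf_sub_eq_zero hke hv0 (hT.inf_eq_zero_of_fixed hk0 (sub_nonneg.2 hve) ?_ ?_)
  · rw [map_sub, hTe, hTv]
  · rw [apply_pow_eq hTS]
    exact inf_sub_iSup_inf_nsmul (hT.1 p hp.1)

lemma iSup_inf_nsmul_le_orbitSup (hT : IsPositiveOp T) (hS : IsRieszHom S) (hSe : S e = e)
    (hp : IsComponent p e) (hTw : T (orbitSup S p) = orbitSup S p) :
    ⨆ k : ℕ, e ⊓ k • T p ≤ orbitSup S p := by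
  have hpw : p ≤ orbitSup S p := (isLUB_orbitSup hS hSe hp).1 ⟨0, rfl⟩
  have hTpw : T p ≤ orbitSup S p := (hT.monotone hpw).trans_eq hTw
  exact ciSup_le fun k => (inf_le_inf_left e (nsmul_le_nsmul_right hTpw k)).trans
    ((orbitSup_isComponent hS hSe hp).inf_nsmul_le k)

lemma bandProj_bandGenerated_map_eq_orbitSup [IsOrderedModule ℝ E] (hT : IsStrictlyPositiveOp T)
    (hproj : ∀ f, T (T f) = T f) (hTe : T e = e) (hS : IsRieszHom S)
    (hTS : ∀ f, T (S f) = T f) (hSe : S e = e) (hp : IsComponent p e)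
    (hTw : T (orbitSup S p) = orbitSup S p) :
    bandProj (bandGenerated (T p)) e = orbitSup S p := by
  rw [bandProj_bandGenerated_eq_iSup (hp.1.trans hp.2.1) (hT.1 p hp.1)]
  exact le_antisymm (iSup_inf_nsmul_le_orbitSup hT.1 hS hSe hp hTw)
    (orbitSup_le_iSup_inf_nsmul hT hproj hTe hS hTS hSe hp)

lemma nsmul_map_le_map_iSup (hT : IsPositiveOp T) (hS : IsRieszHom S) (hTS : ∀ f, T (S f) = T f)
    {q : E} (hq : 0 ≤ q) {n : ℕ} (hn : n ≠ 0)
    (hdisj : ∀ i < n, ∀ j < n, i ≠ j → (S ^ i) q ⊓ (S ^ j) q = 0) :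
    n • T q ≤ T (⨆ j : Fin n, (S ^ (j : ℕ)) q) := by
  have hq0 (i : ℕ) : 0 ≤ (S ^ i) q := (hS.pow i).map_nonneg hq
  have hle (i : Fin n) : (S ^ (i : ℕ)) q ≤ ⨆ j : Fin n, (S ^ (j : ℕ)) q :=
    le_ciSup (f := fun j : Fin n => (S ^ (j : ℕ)) q) (Set.finite_range _).bddAbove i
  have hsum : ∑ i : Fin n, (S ^ (i : ℕ)) q ≤ ⨆ j : Fin n, (S ^ (j : ℕ)) q :=
    sum_le_of_pairwise_inf_eq_zero ((hq0 0).trans (hle ⟨0, Nat.pos_of_ne_zero hn⟩))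
      (fun i _ => hq0 i) (fun i _ j _ hij => hdisj i i.2 j j.2 (Fin.val_ne_of_ne hij))
      fun i _ => hle i
  simpa [map_sum, apply_pow_eq hTS] using hT.monotone hsum

end System

end RieszErgodic

open RieszErgodic in
theorem mainTheorem2_general {E : Type*} [AddCommGroup E] [ConditionallyCompleteLattice E]
    [IsOrderedAddMonoid E] [Module ℝ E] [IsOrderedModule ℝ E] {T S : E →ₗ[ℝ] E} {e : E}
    (hT : IsStrictlyPositiveOp T) (hproj : ∀ f, T (T f) = T f) (hS : IsRieszHom S)
    (hsurj : Function.Surjective S) (hTS : ∀ f, T (S f) = T f) (hinv : ∀ f, S f = f → T f = f)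
    (hSe : S e = e) {n : ℕ} (hn : 1 ≤ n) {p : E} (hp : IsComponent p e) :
    ∃ q : E, IsComponent q (bandProj (bandGenerated (T p)) e) ∧
      (∀ i < n, ∀ j < n, i ≠ j → RieszDisjoint ((S ^ i) q) ((S ^ j) q)) ∧
      (bandProj (bandGenerated (T p)) e - ((n : ℝ) - 1) • T p)⁺ ≤
        T (⨆ j : Fin n, (S ^ (j : ℕ)) q) := by
  obtain ⟨m, rfl⟩ := Nat.exists_eq_add_of_le' hn
  have hSw := map_orbitSup hT hS hsurj hTS hSe hp
  have hTw := hinv _ hSw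
  rw [bandProj_bandGenerated_map_eq_orbitSup hT hproj (hinv e hSe) hS hTS hSe hp hTw]
  obtain ⟨q, hq, hdisj, hle⟩ :=
    exists_tower hS (hS.injective_of_comp_eq hT hTS) hsurj hSe hp hSw m
  have hq0 (i : ℕ) : 0 ≤ (S ^ i) q := (hS.pow i).map_nonneg hq.1
  have htower := nsmul_map_le_map_iSup hT.1 hS hTS hq.1 m.succ_ne_zero hdisj
  refine ⟨q, hq, fun i hi j hj hij =>
    rieszDisjoint_of_inf_eq_zero (hq0 i) (hq0 j) (hdisj i hi j hj hij), sup_le ?_ ?_⟩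
  · have hcover : orbitSup S p ≤ (m + 1) • T q + m • T p := by
      simpa [map_sum, apply_pow_eq hTS, hTw] using hT.1.monotone hle
    rw [Nat.cast_succ, add_sub_cancel_right, Nat.cast_smul_eq_nsmul, sub_le_iff_le_add]
    exact hcover.trans (add_le_add_left htower _)
  · exact (nsmul_nonneg (hT.1 q hq.1) _).trans htower

open RieszErgodic in
theorem mainTheorem2 {E : Type*} [AddCommGroup E] [ConditionallyCompleteLattice E]
    [IsOrderedAddMonoid E] [Module ℝ E] [IsOrderedModule ℝ E]
    (T S : E →ₗ[ℝ] E) (e : E)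
    (hsys : IsCEPS T S e) (hT : IsStrictlyPositiveOp T)
    (herg : IsConditionallyErgodic T S) (hS : Function.Surjective S)
    (n : ℕ) (hn : 1 ≤ n) (p : E) (hp : IsComponent p e) :
    ∃ q : E, IsComponent q (bandProj (bandGenerated (T p)) e) ∧
      (∀ i < n, ∀ j < n, i ≠ j → RieszDisjoint ((S ^ i) q) ((S ^ j) q)) ∧
      (bandProj (bandGenerated (T p)) e - ((n : ℝ) - 1) • T p)⁺ ≤
        T (⨆ j : Fin n, (S ^ (j : ℕ)) q) :=
  mainTheorem2_general hT hsys.condExp.projection hsys.rieszHom hS hsys.T_comp_S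
    (fun _ => herg.map_eq_of_fixed) hsys.S_unit hn hp
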